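/- For a formal power series $f(x)$ let its run transform be the bivariate formal power series $$\Phi(f)(x,y)=\frac{1-x}{1-xy}\,f\!\left(\frac{x(1-x)}{1-xy}\right).$$ For $n\ge 0$ let $\mathcal{E}_n$ be the set of permutations of $[2n]=\{1,\dots,2n\}$ all of whose cycles have even length (fixed points being cycles of length $1$), and let $f(x)=\sum_{n\ge 0}|\mathcal{E}_n|\,x^n$. Then $\Phi(f)$ counts these permutations by $n$ and by the number of cycles that consist of consecutive integers in increasing order ending at an even integer: for all $n,k\ge 0$, the coefficient of $x^n y^k$ in $\Phi(f)(x,y)$ is the number of permutations in $\mathcal{E}_n$ having exactly $k$ cycles of the form $(a,a+1,\dots,b)$ with $b$ even, that is, cycles mapping $i\mapsto i+1$ for $a\le i<b$ and $b\mapsto a$. -/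

import Mathlib

/-- The run transform
`Φ(f)(x, y) = (1 - x) / (1 - x y) * f (x (1 - x) / (1 - x y))`
of a formal power series `f`, as a formal power series in the two variables
`x` (variable `0`) and `y` (variable `1`). The series `1 - x y` is invertible, and the series
that is substituted into `f` has constant term zero. -/
noncomputable def runTransform (f : PowerSeries ℚ) : MvPowerSeries (Fin 2) ℚ :=
  let x : MvPowerSeries (Fin 2) ℚ := MvPowerSeries.X 0
  let y : MvPowerSeries (Fin 2) ℚ := MvPowerSeries.X 1
  (1 - x) * (1 - x * y)⁻¹ * PowerSeries.subst (x * (1 - x) * (1 - x * y)⁻¹) f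

/-- Every cycle of `σ` has even length; the parts of `σ.partition` are the lengths of all
cycles of `σ`, where fixed points count as cycles of length `1`. -/
def AllCyclesEven {m : ℕ} (σ : Equiv.Perm (Fin m)) : Prop :=
  ∀ l ∈ σ.partition.parts, Even l

instance {m : ℕ} (σ : Equiv.Perm (Fin m)) : Decidable (AllCyclesEven σ) :=
  inferInstanceAs (Decidable (∀ l ∈ σ.partition.parts, Even l))

/-- The cycle `c` consists of consecutive integers in increasing order, the last of which is even:
`c = (a, a + 1, …, b)`. The element `i : Fin m` stands for the integer `i + 1` of
`[m] = {1, …, m}`. -/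
def IsEvenRun {m : ℕ} (c : Equiv.Perm (Fin m)) : Prop :=
  ∃ a b : Fin m, a ≤ b ∧ c.support = Finset.Icc a b ∧
    (∀ i : Fin m, a ≤ i → i < b → (c i : ℕ) = i + 1) ∧ c b = a ∧ Even ((b : ℕ) + 1)

instance {m : ℕ} (c : Equiv.Perm (Fin m)) : Decidable (IsEvenRun c) :=
  inferInstanceAs (Decidable (∃ a b : Fin m, a ≤ b ∧ c.support = Finset.Icc a b ∧
    (∀ i : Fin m, a ≤ i → i < b → (c i : ℕ) = i + 1) ∧ c b = a ∧ Even ((b : ℕ) + 1)))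

/-- The number of cycles of `σ` that consist of consecutive integers in increasing order and end
at an even integer. (Such a cycle is never a fixed point if all cycles of `σ` have even length, so
that the nontrivial cycles in `σ.cycleFactorsFinset` are all that is needed.) -/
def numEvenRuns {m : ℕ} (σ : Equiv.Perm (Fin m)) : ℕ :=
  (σ.cycleFactorsFinset.filter IsEvenRun).card

/-- The permutations of `[2n]` in which each cycle has even length. -/
def evenCyclePerms (n : ℕ) : Finset (Equiv.Perm (Fin (2 * n))) :=
  Finset.univ.filter AllCyclesEven

/-- The generating function, by size `n`, of the permutations of `[2n]` in which each cycle has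
even length. -/
noncomputable def evenCycleGF : PowerSeries ℚ :=
  PowerSeries.mk fun n => ((evenCyclePerms n).card : ℚ)

/-! Both sides expand over families `J` of disjoint intervals in `[0, n)`, with weight `(y - 1) ^
|J|` times the coefficient of `f` at the number of uncovered points; this is `intervalPoly`. For
`Φ(f)`, splitting `f` into its constant term and `x` times its shift gives a recursion in `n`. The
interval sum satisfies the same recursion, according to whether some interval ends at the last point
(`coeff_runTransform`). For permutations, a run of even length ending at an even integer starts at
an odd one, so it is an interval with every point doubled. Expanding `y ^ r = ((y - 1) + 1) ^ r`
over subsets of the runs leaves the count of permutations containing a prescribed family `J`.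
Deleting these runs leaves an arbitrary permutation with even cycles on the remaining points
(`card_subset_runSet`). -/

section

open Finset Polynomial Equiv

/-! ### Recursion for the run transform -/

/-- The series `f` with its constant term dropped, divided by the variable. -/
noncomputable def PowerSeries.shift (f : PowerSeries ℚ) : PowerSeries ℚ :=
  PowerSeries.mk fun n => PowerSeries.coeff (n + 1) f

/-- Substitution turns the variable split off from `f` into `x (1 - x) / (1 - x y)`; the denominator
is then cleared. -/
theorem runTransform_mul (f : PowerSeries ℚ) :
    (1 - MvPowerSeries.X 0 * MvPowerSeries.X 1) * runTransform f =
      (1 - MvPowerSeries.X 0) *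
        (MvPowerSeries.C (PowerSeries.constantCoeff f) +
          MvPowerSeries.X 0 * runTransform f.shift) := by
  have hu : (1 - MvPowerSeries.X 0 * MvPowerSeries.X 1 : MvPowerSeries (Fin 2) ℚ) *
      (1 - MvPowerSeries.X 0 * MvPowerSeries.X 1)⁻¹ = 1 :=
    MvPowerSeries.mul_inv_cancel _ (by simp)
  have hs : PowerSeries.HasSubst (MvPowerSeries.X 0 * (1 - MvPowerSeries.X 0) *
      (1 - MvPowerSeries.X 0 * MvPowerSeries.X 1)⁻¹ : MvPowerSeries (Fin 2) ℚ) :=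
    PowerSeries.HasSubst.of_constantCoeff_zero (by simp)
  have hf : f = PowerSeries.X * f.shift + PowerSeries.C (PowerSeries.constantCoeff f) :=
    f.eq_X_mul_shift_add_const
  unfold runTransform
  conv_lhs => rw [hf]
  simp only [PowerSeries.subst_add hs, PowerSeries.subst_mul hs, PowerSeries.subst_X hs,
    PowerSeries.subst_C]
  generalize (1 - MvPowerSeries.X 0 * MvPowerSeries.X 1 : MvPowerSeries (Fin 2) ℚ)⁻¹ = v at *
  generalize PowerSeries.subst (_ : MvPowerSeries (Fin 2) ℚ) f.shift = g
  linear_combination (1 - MvPowerSeries.X 0) * (MvPowerSeries.X 0 * (1 - MvPowerSeries.X 0) * v * g +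
    MvPowerSeries.C (PowerSeries.constantCoeff f)) * hu

/-- The coefficient of `x ^ n * y ^ k`. -/
noncomputable abbrev coeffXY (n k : ℕ) (F : MvPowerSeries (Fin 2) ℚ) : ℚ :=
  MvPowerSeries.coeff (Finsupp.single 0 n + Finsupp.single 1 k) F

theorem coeffXY_X_mul_zero (k : ℕ) (F : MvPowerSeries (Fin 2) ℚ) :
    coeffXY 0 k (MvPowerSeries.X 0 * F) = 0 := by
  rw [coeffXY, MvPowerSeries.X, MvPowerSeries.coeff_monomial_mul, if_neg]
  intro h
  have := h 0
  simp at this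

theorem coeffXY_X_mul_succ (n k : ℕ) (F : MvPowerSeries (Fin 2) ℚ) :
    coeffXY (n + 1) k (MvPowerSeries.X 0 * F) = coeffXY n k F := by
  have : (Finsupp.single 0 (n + 1) + Finsupp.single 1 k : Fin 2 →₀ ℕ) =
      Finsupp.single 0 1 + (Finsupp.single 0 n + Finsupp.single 1 k) := by
    rw [add_comm n 1, Finsupp.single_add, add_assoc]
  rw [coeffXY, this, MvPowerSeries.X, MvPowerSeries.coeff_add_monomial_mul, one_mul]

theorem coeffXY_Y_mul_zero (n : ℕ) (F : MvPowerSeries (Fin 2) ℚ) :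
    coeffXY n 0 (MvPowerSeries.X 1 * F) = 0 := by
  rw [coeffXY, MvPowerSeries.X, MvPowerSeries.coeff_monomial_mul, if_neg]
  intro h
  have := h 1
  simp at this

theorem coeffXY_Y_mul_succ (n k : ℕ) (F : MvPowerSeries (Fin 2) ℚ) :
    coeffXY n (k + 1) (MvPowerSeries.X 1 * F) = coeffXY n k F := by
  have : (Finsupp.single 0 n + Finsupp.single 1 (k + 1) : Fin 2 →₀ ℕ) =
      Finsupp.single 1 1 + (Finsupp.single 0 n + Finsupp.single 1 k) := by
    rw [add_comm k 1, Finsupp.single_add]; abel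
  rw [coeffXY, this, MvPowerSeries.X, MvPowerSeries.coeff_add_monomial_mul, one_mul]

theorem coeffXY_C (n k : ℕ) (a : ℚ) :
    coeffXY n k (MvPowerSeries.C a) = if n = 0 ∧ k = 0 then a else 0 := by
  classical
  rw [coeffXY, MvPowerSeries.coeff_C]
  congr 1
  simp

theorem runTransform_eq (f : PowerSeries ℚ) :
    runTransform f = MvPowerSeries.X 0 * (MvPowerSeries.X 1 * runTransform f) +
      MvPowerSeries.C (PowerSeries.constantCoeff f) -
      MvPowerSeries.X 0 * MvPowerSeries.C (PowerSeries.constantCoeff f) +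
      MvPowerSeries.X 0 * runTransform f.shift -
      MvPowerSeries.X 0 * (MvPowerSeries.X 0 * runTransform f.shift) := by
  linear_combination runTransform_mul f

/-- A sequence of polynomials that satisfies the run recursion gives the coefficients of the
run transform. -/
theorem coeffXY_runTransform_eq_of_rec (A : PowerSeries ℚ → ℕ → ℚ[X])
    (h0 : ∀ f, A f 0 = C (PowerSeries.constantCoeff f))
    (h1 : ∀ f n, A f (n + 1) = A f.shift n + (X - 1) * ∑ a ∈ range (n + 1), A f a)
    (n k : ℕ) (f : PowerSeries ℚ) : coeffXY n k (runTransform f) = (A f n).coeff k := by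
  -- Subtracting consecutive instances of `h1` removes the sum and leaves the shape of
  -- `runTransform_eq`. Its constant part `(1 - x) f(0)` affects only `n = 0` and `n = 1`, hence two
  -- base cases below.
  have h2 : ∀ f n, A f (n + 2) = X * A f (n + 1) + A f.shift (n + 1) - A f.shift n := by
    intro f n
    rw [h1 f (n + 1), sum_range_succ]
    linear_combination -h1 f n
  have hX : ∀ n f, (∀ k, coeffXY n k (runTransform f) = (A f n).coeff k) → ∀ k,
      coeffXY n k (MvPowerSeries.X 1 * runTransform f) = (X * A f n).coeff k := by
    intro n f h k
    cases k with
    | zero => rw [coeffXY_Y_mul_zero]; simp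
    | succ k => rw [coeffXY_Y_mul_succ, h, coeff_X_mul]
  induction n using Nat.strong_induction_on generalizing k f with
  | _ n ih =>
    rw [runTransform_eq f]
    simp only [coeffXY, map_add, map_sub]
    match n with
    | 0 =>
      have := coeffXY_C 0 k (PowerSeries.constantCoeff f)
      simp only [coeffXY_X_mul_zero, this, h0, coeff_C]
      simp
    | 1 =>
      have e1 := coeffXY_C 1 k (PowerSeries.constantCoeff f)
      have e0 := coeffXY_C 0 k (PowerSeries.constantCoeff f)
      simp only [coeffXY_X_mul_succ 0, coeffXY_X_mul_zero, e1, e0,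
        hX 0 f (fun k => ih 0 (by omega) k f), ih 0 (by omega) k f.shift]
      rw [h1]
      simp [h0, coeff_C, sub_mul]
      ring
    | n + 2 =>
      have e1 := coeffXY_C (n + 2) k (PowerSeries.constantCoeff f)
      have e0 := coeffXY_C (n + 1) k (PowerSeries.constantCoeff f)
      simp only [coeffXY_X_mul_succ, e1, e0,
        hX (n + 1) f (fun k => ih (n + 1) (by omega) k f), ih (n + 1) (by omega) k f.shift,
        ih n (by omega) k f.shift]
      rw [h2]
      simp

/-! ### Families of disjoint intervals -/

/-- `J` is a set of pairwise disjoint nonempty half-open intervals `[a, b)` contained in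
`[0, n)`, each given as a pair `(a, b)`. -/
def IsIntervalFamily (n : ℕ) (J : Finset (ℕ × ℕ)) : Prop :=
  (∀ q ∈ J, q.1 < q.2 ∧ q.2 ≤ n) ∧ ∀ q ∈ J, ∀ r ∈ J, q ≠ r → q.2 ≤ r.1 ∨ r.2 ≤ q.1

instance (n : ℕ) (J : Finset (ℕ × ℕ)) : Decidable (IsIntervalFamily n J) :=
  inferInstanceAs (Decidable (_ ∧ _))

/-- All families of pairwise disjoint nonempty intervals in `[0, n)`. -/
def intervalFamilies (n : ℕ) : Finset (Finset (ℕ × ℕ)) :=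
  ((range (n + 1) ×ˢ range (n + 1)).powerset).filter (IsIntervalFamily n)

/-- The total length of a family of intervals. -/
def totalLength (J : Finset (ℕ × ℕ)) : ℕ := ∑ q ∈ J, (q.2 - q.1)

theorem mem_intervalFamilies {n : ℕ} {J : Finset (ℕ × ℕ)} :
    J ∈ intervalFamilies n ↔ IsIntervalFamily n J := by
  simp only [intervalFamilies, mem_filter, mem_powerset, and_iff_right_iff_imp]
  intro h q hq
  have := h.1 q hq
  simp only [mem_product, mem_range]
  omega

theorem intervalFamilies_zero : intervalFamilies 0 = {∅} := by
  ext J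
  rw [mem_intervalFamilies, mem_singleton]
  refine ⟨fun h => eq_empty_of_forall_notMem fun q hq => ?_, ?_⟩
  · have := h.1 q hq
    omega
  · rintro rfl
    simp [IsIntervalFamily]

theorem notMem_of_intervalFamilies {n a b : ℕ} {J : Finset (ℕ × ℕ)} (h : IsIntervalFamily n J)
    (hb : n < b) : (a, b) ∉ J := by
  intro hq
  have := (h.1 _ hq).2
  simp only at this
  omega

/-- Either no interval ends at `n + 1`, or exactly one does, say `[a, n + 1)`, and disjointness
forces all others into `[0, a)`. -/
theorem sum_intervalFamilies_succ {M : Type*} [AddCommMonoid M] (n : ℕ)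
    (w : Finset (ℕ × ℕ) → M) :
    ∑ J ∈ intervalFamilies (n + 1), w J = ∑ J ∈ intervalFamilies n, w J +
      ∑ a ∈ range (n + 1), ∑ J ∈ intervalFamilies a, w (insert (a, n + 1) J) := by
  have key : intervalFamilies (n + 1) = intervalFamilies n ∪
      (range (n + 1)).biUnion fun a => (intervalFamilies a).image (insert (a, n + 1)) := by
    ext J
    simp only [mem_union, mem_biUnion, mem_image, mem_range, mem_intervalFamilies]
    constructor
    · intro h
      by_cases hJ : ∃ a, (a, n + 1) ∈ J
      · obtain ⟨a, ha⟩ := hJ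
        have hlt := h.1 _ ha
        simp only at hlt
        refine .inr ⟨a, by omega, J.erase (a, n + 1), ⟨fun q hq => ?_, fun q hq r hr => ?_⟩,
          insert_erase ha⟩
        · have hq' := mem_erase.1 hq
          have h1 := h.1 q hq'.2
          have h2 := h.2 q hq'.2 _ ha hq'.1
          simp only at h2
          omega
        · exact h.2 q (mem_of_mem_erase hq) r (mem_of_mem_erase hr)
      · refine .inl ⟨fun q hq => ?_, h.2⟩
        have h1 := h.1 q hq
        have : q.2 ≠ n + 1 := fun e => hJ ⟨q.1, by rw [← e]; exact hq⟩
        omega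
    · rintro (h | ⟨a, ha, K, hK, rfl⟩)
      · exact ⟨fun q hq => by have := h.1 q hq; omega, h.2⟩
      · refine ⟨fun q hq => ?_, fun q hq r hr hqr => ?_⟩
        · rcases mem_insert.1 hq with rfl | hq
          · simp only; omega
          · have := hK.1 q hq; omega
        · rcases mem_insert.1 hq with rfl | hq <;> rcases mem_insert.1 hr with rfl | hr
          · exact absurd rfl hqr
          · exact .inr (hK.1 r hr).2
          · exact .inl (hK.1 q hq).2
          · exact hK.2 q hq r hr hqr
  have hmem : ∀ {a J}, J ∈ (intervalFamilies a).image (insert (a, n + 1)) →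
      (a, n + 1) ∈ J := by
    intro a J h
    obtain ⟨K, -, rfl⟩ := mem_image.1 h
    exact mem_insert_self _ _
  rw [key, sum_union, sum_biUnion]
  · congr 1
    refine sum_congr rfl fun a ha => sum_image fun J hJ K hK hJK => ?_
    have han : a < n + 1 := mem_range.1 ha
    rw [← erase_insert (notMem_of_intervalFamilies (mem_intervalFamilies.1 hJ) han),
      ← erase_insert (notMem_of_intervalFamilies (mem_intervalFamilies.1 hK) han)]
    exact congrArg (Finset.erase · (a, n + 1)) hJK
  · intro a ha b hb hab
    refine disjoint_left.2 fun J hJ hJ' => ?_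
    obtain ⟨K, hK, rfl⟩ := mem_image.1 hJ
    rcases mem_insert.1 (hmem hJ') with h | h
    · exact hab (congrArg Prod.fst h).symm
    · exact notMem_of_intervalFamilies (mem_intervalFamilies.1 hK) (mem_range.1 ha) h
  · refine disjoint_left.2 fun J hJ hJ' => ?_
    obtain ⟨a, -, ha⟩ := mem_biUnion.1 hJ'
    exact notMem_of_intervalFamilies (mem_intervalFamilies.1 hJ) n.lt_succ_self (hmem ha)

theorem pairwiseDisjoint_Ico {n : ℕ} {J : Finset (ℕ × ℕ)} (h : IsIntervalFamily n J) :
    (J : Set (ℕ × ℕ)).PairwiseDisjoint fun q => Ico q.1 q.2 := by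
  intro q hq r hr hqr
  refine disjoint_left.2 fun x hx hx' => ?_
  have := h.2 q hq r hr hqr
  rw [mem_Ico] at hx hx'
  omega

theorem totalLength_eq_card {n : ℕ} {J : Finset (ℕ × ℕ)} (h : IsIntervalFamily n J) :
    totalLength J = (J.biUnion fun q => Ico q.1 q.2).card := by
  rw [card_biUnion (pairwiseDisjoint_Ico h)]
  simp [totalLength]

theorem totalLength_le {n : ℕ} {J : Finset (ℕ × ℕ)} (h : IsIntervalFamily n J) :
    totalLength J ≤ n := by
  rw [totalLength_eq_card h]
  refine (card_le_card (t := range n) fun x hx => ?_).trans (card_range n).le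
  obtain ⟨q, hq, hx⟩ := mem_biUnion.1 hx
  have := h.1 q hq
  rw [mem_Ico] at hx
  rw [mem_range]
  omega

/-- The sum over all families of disjoint intervals in `[0, n)` of `(y - 1)` to the number of
intervals, weighted by the coefficient of `f` at the number of uncovered points. -/
noncomputable def intervalPoly (f : PowerSeries ℚ) (n : ℕ) : ℚ[X] :=
  ∑ J ∈ intervalFamilies n, (X - 1) ^ J.card * C (PowerSeries.coeff (n - totalLength J) f)

theorem intervalPoly_zero (f : PowerSeries ℚ) :
    intervalPoly f 0 = C (PowerSeries.constantCoeff f) := by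
  simp [intervalPoly, intervalFamilies_zero]

theorem intervalPoly_succ (f : PowerSeries ℚ) (n : ℕ) :
    intervalPoly f (n + 1) =
      intervalPoly f.shift n + (X - 1) * ∑ a ∈ range (n + 1), intervalPoly f a := by
  rw [intervalPoly, sum_intervalFamilies_succ, intervalPoly, mul_sum]
  congr 1
  · refine sum_congr rfl fun J hJ => ?_
    have := totalLength_le (mem_intervalFamilies.1 hJ)
    rw [PowerSeries.shift, PowerSeries.coeff_mk, Nat.sub_add_comm this]
  · refine sum_congr rfl fun a ha => ?_
    rw [intervalPoly, mul_sum]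
    refine sum_congr rfl fun J hJ => ?_
    have hJ := mem_intervalFamilies.1 hJ
    have hn := notMem_of_intervalFamilies (a := a) hJ (mem_range.1 ha)
    have hl := totalLength_le hJ
    have ha := mem_range.1 ha
    have : n + 1 - totalLength (insert (a, n + 1) J) = a - totalLength J := by
      rw [totalLength, sum_insert hn, ← totalLength]
      simp only
      omega
    rw [this, card_insert_of_notMem hn, pow_succ']
    ring

theorem coeff_runTransform (f : PowerSeries ℚ) (n k : ℕ) :
    MvPowerSeries.coeff (Finsupp.single 0 n + Finsupp.single 1 k) (runTransform f) =
      (intervalPoly f n).coeff k :=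
  coeffXY_runTransform_eq_of_rec intervalPoly intervalPoly_zero intervalPoly_succ n k f

/-! ### Permutations with even cycles -/

/-- Every power of `σ` that has a fixed point has even exponent; on a finite type this says that
all cycles of `σ` have even length. -/
def EvenPeriods {α : Type*} (σ : Perm α) : Prop := ∀ (x : α) (k : ℕ), (σ ^ k) x = x → Even k

/-- The pointwise form transfers along bijections and to invariant subsets without computing cycle
types. -/
theorem allCyclesEven_iff_evenPeriods {m : ℕ} (σ : Perm (Fin m)) :
    AllCyclesEven σ ↔ EvenPeriods σ := by
  unfold AllCyclesEven
  rw [Perm.parts_partition]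
  constructor
  · intro h x k hk
    by_cases hx : σ x = x
    · have : (1 : ℕ) ∈ σ.cycleType + Multiset.replicate (Fintype.card (Fin m) - σ.support.card) 1 := by
        rw [Multiset.mem_add, Multiset.mem_replicate]
        refine .inr ⟨?_, rfl⟩
        have : σ.support.card < Fintype.card (Fin m) :=
          card_lt_univ_of_notMem (x := x) (by simpa using hx)
        omega
      simpa using h 1 this
    · have hc := σ.isCycle_cycleOf hx
      have h1 : (σ.cycleOf x) ^ k = 1 :=
        hc.pow_eq_one_iff.2 ⟨x, by simpa using hx, by rw [Perm.cycleOf_pow_apply_self, hk]⟩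
      have h2 := orderOf_dvd_of_pow_eq_one h1
      rw [hc.orderOf] at h2
      refine (h _ (Multiset.mem_add.2 (.inl ?_))).trans_dvd h2
      rw [Perm.cycleType_def]
      exact Multiset.mem_map_of_mem _ (Finset.mem_def.1
        (Perm.cycleOf_mem_cycleFactorsFinset_iff.2 (Perm.mem_support.2 hx)))
  · intro h l hl
    rcases Multiset.mem_add.1 hl with hl | hl
    · rw [Perm.cycleType_def] at hl
      obtain ⟨c, hc, rfl⟩ := Multiset.mem_map.1 hl
      have hc : c ∈ σ.cycleFactorsFinset := hc
      have hcyc := (Perm.mem_cycleFactorsFinset_iff.1 hc).1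
      obtain ⟨x, hx⟩ := hcyc.nonempty_support
      refine h x _ ?_
      rw [← Perm.cycleOf_pow_apply_self, ← Perm.cycle_is_cycleOf hx hc, Function.comp_apply,
        ← hcyc.orderOf, pow_orderOf_eq_one, Perm.one_apply]
    · rw [Multiset.mem_replicate] at hl
      obtain ⟨x, hx⟩ : ∃ x, x ∉ σ.support := by
        by_contra! H
        rw [eq_univ_iff_forall.2 H] at hl
        simp at hl
      rw [hl.2]
      exact h x 1 (by simpa using hx)

theorem EvenPeriods.permCongr {α β : Type*} (e : α ≃ β) {σ : Perm α} (h : EvenPeriods σ) :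
    EvenPeriods (e.permCongr σ) := by
  intro x k hk
  refine h (e.symm x) k ?_
  have : (e.permCongr σ) ^ k = e.permCongr (σ ^ k) := (map_pow e.permCongrHom σ k).symm
  rw [this, Equiv.permCongr_apply] at hk
  rw [Equiv.eq_symm_apply, hk]

open Classical in
theorem card_evenPeriods {α : Type*} [Fintype α] {n : ℕ} (h : Fintype.card α = 2 * n) :
    ((univ : Finset (Perm α)).filter EvenPeriods).card = (evenCyclePerms n).card := by
  have e : α ≃ Fin (2 * n) := Fintype.equivFinOfCardEq h
  refine card_equiv e.permCongr fun σ => ?_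
  simp only [evenCyclePerms, mem_filter, mem_univ, true_and, allCyclesEven_iff_evenPeriods]
  refine ⟨EvenPeriods.permCongr e, fun h => ?_⟩
  have := h.permCongr e.symm
  rwa [← Equiv.permCongr_symm, Equiv.symm_apply_apply] at this

theorem evenPeriods_subtypeCongr {α : Type*} {p : α → Prop} [DecidablePred p]
    {τ : Perm {x // p x}} (hτ : EvenPeriods τ) (π : Perm {x // ¬p x}) :
    EvenPeriods (Perm.subtypeCongr τ π) ↔ EvenPeriods π := by
  have hpow : ∀ k, (Perm.subtypeCongr τ π) ^ k = Perm.subtypeCongr (τ ^ k) (π ^ k) := fun k =>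
    (map_pow (Perm.subtypeCongrHom p) (τ, π) k).symm
  constructor
  · intro h x k hk
    refine h x k ?_
    rw [hpow, Perm.subtypeCongr.right_apply_subtype, hk]
  · intro h x k hk
    rw [hpow] at hk
    by_cases hx : p x
    · rw [Perm.subtypeCongr.left_apply _ _ hx] at hk
      exact hτ ⟨x, hx⟩ k (Subtype.ext hk)
    · rw [Perm.subtypeCongr.right_apply _ _ hx] at hk
      exact h ⟨x, hx⟩ k (Subtype.ext hk)

open Classical in
theorem card_evenPeriods_extending {α : Type*} [Fintype α] (p : α → Prop)
    (τ : Perm {x // p x}) (hτ : EvenPeriods τ) {n : ℕ}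
    (hn : Nat.card {x // ¬p x} = 2 * n) :
    ((univ : Finset (Perm α)).filter
      fun σ => EvenPeriods σ ∧ ∀ x : {x // p x}, σ (x : α) = (τ x : α)).card = (evenCyclePerms n).card := by
  rw [Nat.card_eq_fintype_card] at hn
  rw [← card_evenPeriods hn]
  symm
  refine card_bij (fun (π : Perm {x // ¬p x}) _ => (Perm.subtypeCongr τ π : Perm α)) ?_ ?_ ?_
  · intro π hπ
    simp only [mem_filter, mem_univ, true_and] at hπ ⊢
    exact ⟨(evenPeriods_subtypeCongr hτ π).2 hπ,
      fun x => Perm.subtypeCongr.left_apply_subtype τ π x⟩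
  · intro π _ ρ _ h
    ext x
    have := congrArg (fun f : Perm α => f x) h
    simpa only [Perm.subtypeCongr.right_apply_subtype] using this
  · intro σ hσ
    simp only [mem_filter, mem_univ, true_and] at hσ
    have hp : ∀ x, p (σ x) ↔ p x := by
      refine fun x => ⟨fun h => ?_, fun h => by rw [hσ.2 ⟨x, h⟩]; exact (τ _).2⟩
      -- The preimage of `σ x` under `τ` is also sent to `σ x` by `σ`, so injectivity identifies it
      -- with `x`.
      have h1 := hσ.2 (τ.symm ⟨σ x, h⟩)
      rw [Equiv.apply_symm_apply] at h1
      rw [← σ.injective h1]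
      exact (τ.symm _).2
    have hn : ∀ x, ¬p (σ x) ↔ ¬p x := fun x => not_congr (hp x)
    have hσ' : Perm.subtypeCongr τ (σ.subtypePerm hn) = σ := by
      ext x
      by_cases hx : p x
      · rw [Perm.subtypeCongr.left_apply _ _ hx]
        exact (hσ.2 ⟨x, hx⟩).symm
      · rw [Perm.subtypeCongr.right_apply _ _ hx]
        rfl
    refine ⟨σ.subtypePerm hn, ?_, hσ'⟩
    simp only [mem_filter, mem_univ, true_and]
    rw [← evenPeriods_subtypeCongr hτ, hσ']
    exact hσ.1

/-! ### Runs as doubled intervals -/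

/-- With `q = (a, b)`, the permutation `σ` maps `i` to `i + 1` for `2 * a ≤ i < 2 * b - 1`
and `2 * b - 1` to `2 * a`. -/
def HasRun {m : ℕ} (σ : Perm (Fin m)) (q : ℕ × ℕ) : Prop :=
  ∀ i : Fin m, 2 * q.1 ≤ i → (i : ℕ) < 2 * q.2 →
    (σ i : ℕ) = if (i : ℕ) + 1 = 2 * q.2 then 2 * q.1 else i + 1

instance {m : ℕ} (σ : Perm (Fin m)) (q : ℕ × ℕ) : Decidable (HasRun σ q) :=
  inferInstanceAs (Decidable (∀ _, _))

/-- The pairs `(a, b)` such that `σ` has a cycle `2 * a ↦ 2 * a + 1 ↦ ⋯ ↦ 2 * b - 1 ↦ 2 * a`. -/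
def runSet {n : ℕ} (σ : Perm (Fin (2 * n))) : Finset (ℕ × ℕ) :=
  (range (n + 1) ×ˢ range (n + 1)).filter fun q => q.1 < q.2 ∧ HasRun σ q

theorem mem_runSet {n : ℕ} {σ : Perm (Fin (2 * n))} {q : ℕ × ℕ} :
    q ∈ runSet σ ↔ q.1 < q.2 ∧ q.2 ≤ n ∧ HasRun σ q := by
  simp only [runSet, mem_filter, mem_product, mem_range]
  constructor
  · rintro ⟨⟨-, h⟩, h1, h2⟩
    exact ⟨h1, by omega, h2⟩
  · rintro ⟨h1, h2, h3⟩
    exact ⟨⟨by omega, by omega⟩, h1, h3⟩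

/-- At the last point of the run that ends first, one run closes up while the other would continue;
so the ends agree, and then so do the starts. -/
theorem HasRun.eq_of_le {m : ℕ} {σ : Perm (Fin m)} {q r : ℕ × ℕ} (hq : HasRun σ q)
    (hr : HasRun σ r) (hqm : 2 * q.2 ≤ m) (hrm : 2 * r.2 ≤ m) (hr2 : r.1 < r.2)
    (hqr : q.1 ≤ r.1) (hrq : r.1 < q.2) : q = r := by
  rcases lt_trichotomy q.2 r.2 with h | h | h
  · have h1 := hq ⟨2 * q.2 - 1, by omega⟩ (by simp only; omega) (by simp only; omega)
    have h2 := hr ⟨2 * q.2 - 1, by omega⟩ (by simp only; omega) (by simp only; omega)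
    simp only at h1 h2
    split_ifs at h1 h2 <;> omega
  · have h1 := hq ⟨2 * q.2 - 1, by omega⟩ (by simp only; omega) (by simp only; omega)
    have h2 := hr ⟨2 * q.2 - 1, by omega⟩ (by simp only; omega) (by simp only; omega)
    simp only at h1 h2
    refine Prod.ext ?_ h
    split_ifs at h1 h2 <;> omega
  · have h1 := hq ⟨2 * r.2 - 1, by omega⟩ (by simp only; omega) (by simp only; omega)
    have h2 := hr ⟨2 * r.2 - 1, by omega⟩ (by simp only; omega) (by simp only; omega)
    simp only at h1 h2
    split_ifs at h1 h2 <;> omega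

theorem isIntervalFamily_of_subset_runSet {n : ℕ} {σ : Perm (Fin (2 * n))}
    {J : Finset (ℕ × ℕ)} (hJ : J ⊆ runSet σ) : IsIntervalFamily n J := by
  refine ⟨fun q hq => ?_, fun q hq r hr hqr => ?_⟩
  · obtain ⟨h1, h2, -⟩ := mem_runSet.1 (hJ hq)
    exact ⟨h1, h2⟩
  · obtain ⟨h1, h2, h3⟩ := mem_runSet.1 (hJ hq)
    obtain ⟨h4, h5, h6⟩ := mem_runSet.1 (hJ hr)
    by_contra! H
    rcases le_total q.1 r.1 with h | h
    · exact hqr (h3.eq_of_le h6 (by omega) (by omega) h4 h H.1)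
    · exact hqr (h6.eq_of_le h3 (by omega) (by omega) h1 h H.2).symm

theorem val_cycleIcc {m : ℕ} {a b x : Fin m} (hax : a ≤ x) (hxb : x ≤ b) :
    (Fin.cycleIcc a b x : ℕ) = if x = b then (a : ℕ) else x + 1 := by
  have : NeZero m := ⟨by have := x.2; omega⟩
  rcases hxb.eq_or_lt with rfl | h
  · rw [Fin.cycleIcc_of_last hax, if_pos rfl]
  · rw [Fin.cycleIcc_of_ge_of_lt hax h, if_neg h.ne]
    exact Fin.val_add_one_of_lt' (by have := b.2; have : (x : ℕ) < b := h; omega)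

theorem cycleIcc_apply_of_notMem {m : ℕ} {a b x : Fin m} (hx : x ∉ Icc a b) :
    Fin.cycleIcc a b x = x := by
  rw [mem_Icc, not_and_or, not_le, not_le] at hx
  exact hx.elim Fin.cycleIcc_of_lt Fin.cycleIcc_of_gt

theorem support_cycleIcc {m : ℕ} {a b : Fin m} (hab : a < b) :
    (Fin.cycleIcc a b).support = Icc a b := by
  ext x
  rw [Perm.mem_support]
  constructor
  · intro h
    by_contra hx
    exact h (cycleIcc_apply_of_notMem hx)
  · intro hx h
    have h1 := mem_Icc.1 hx
    have h2 := val_cycleIcc h1.1 h1.2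
    rw [h] at h2
    split_ifs at h2 with h3
    · rw [h3] at h2
      exact hab.ne' (Fin.ext h2)
    · omega

/-- The elements of `Fin m` in the runs of the family `J`. -/
def InRuns {m : ℕ} (J : Finset (ℕ × ℕ)) (x : Fin m) : Prop :=
  ∃ q ∈ J, 2 * q.1 ≤ (x : ℕ) ∧ (x : ℕ) < 2 * q.2

instance {m : ℕ} (J : Finset (ℕ × ℕ)) : DecidablePred (InRuns (m := m) J) := fun x =>
  inferInstanceAs (Decidable (∃ q ∈ J, 2 * q.1 ≤ (x : ℕ) ∧ (x : ℕ) < 2 * q.2))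

theorem exists_perm_hasRun {n : ℕ} {J : Finset (ℕ × ℕ)} (hJ : IsIntervalFamily n J) :
    ∃ τ : Perm (Fin (2 * n)), (∀ q ∈ J, HasRun τ q) ∧ ∀ x, ¬InRuns J x → τ x = x := by
  induction J using Finset.induction_on with
  | empty => exact ⟨1, by simp, fun _ _ => rfl⟩
  | insert q J hq ih =>
    obtain ⟨τ, hτ, hτ'⟩ := ih ⟨fun r hr => hJ.1 r (mem_insert_of_mem hr),
      fun r hr s hs => hJ.2 r (mem_insert_of_mem hr) s (mem_insert_of_mem hs)⟩
    obtain ⟨h1, h2⟩ := hJ.1 q (mem_insert_self _ _)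
    have hd : ∀ r ∈ J, q.2 ≤ r.1 ∨ r.2 ≤ q.1 := fun r hr =>
      hJ.2 q (mem_insert_self _ _) r (mem_insert_of_mem hr) (by rintro rfl; exact hq hr)
    let a : Fin (2 * n) := ⟨2 * q.1, by omega⟩
    let b : Fin (2 * n) := ⟨2 * q.2 - 1, by omega⟩
    have hab : a < b := by simp only [a, b, Fin.lt_def]; omega
    have hmem : ∀ x : Fin (2 * n), x ∈ Icc a b ↔ 2 * q.1 ≤ x ∧ (x : ℕ) < 2 * q.2 := by
      intro x
      simp only [mem_Icc, Fin.le_def, a, b]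
      omega
    -- By disjointness `τ` fixes the new interval pointwise, and the new cycle fixes the old ones.
    refine ⟨τ * Fin.cycleIcc a b, fun r hr => ?_, fun x hx => ?_⟩
    · rcases mem_insert.1 hr with rfl | hr
      · intro i hi hi'
        have hi2 := (hmem i).2 ⟨hi, hi'⟩
        have hc : Fin.cycleIcc a b i ∈ Icc a b := by
          rw [← support_cycleIcc hab, Perm.apply_mem_support, support_cycleIcc hab]
          exact hi2
        rw [Perm.mul_apply, hτ', val_cycleIcc (mem_Icc.1 hi2).1 (mem_Icc.1 hi2).2]
        · have : i = b ↔ (i : ℕ) + 1 = 2 * r.2 := by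
            simp only [Fin.ext_iff, b]
            omega
          simp only [this, a]
        · rintro ⟨s, hs, hs1, hs2⟩
          have := hd s hs
          have := (hmem _).1 hc
          omega
      · intro i hi hi'
        rw [Perm.mul_apply, cycleIcc_apply_of_notMem]
        · exact hτ r hr i hi hi'
        · rw [hmem]
          have := hd r hr
          omega
    · rw [Perm.mul_apply, cycleIcc_apply_of_notMem, hτ']
      · rintro ⟨s, hs, h⟩
        exact hx ⟨s, mem_insert_of_mem hs, h⟩
      · rw [hmem]
        exact fun h => hx ⟨q, mem_insert_self _ _, h⟩

theorem card_not_inRuns {n : ℕ} {J : Finset (ℕ × ℕ)} (hJ : IsIntervalFamily n J) :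
    Nat.card {x : Fin (2 * n) // ¬InRuns J x} = 2 * (n - totalLength J) := by
  have h1 : ((univ : Finset (Fin (2 * n))).filter (InRuns J)).map Fin.valEmbedding =
      J.biUnion fun q => Ico (2 * q.1) (2 * q.2) := by
    ext x
    simp only [mem_map, mem_filter, mem_univ, true_and, mem_biUnion, mem_Ico,
      Fin.valEmbedding_apply]
    constructor
    · rintro ⟨x, hx, rfl⟩
      exact hx
    · rintro ⟨q, hq, hx⟩
      have := hJ.1 q hq
      exact ⟨⟨x, by omega⟩, ⟨q, hq, hx⟩, rfl⟩
  have h2 : ((univ : Finset (Fin (2 * n))).filter (InRuns J)).card = 2 * totalLength J := by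
    rw [← card_map, h1, card_biUnion, totalLength, mul_sum]
    · refine sum_congr rfl fun q _ => ?_
      rw [Nat.card_Ico]
      omega
    · intro q hq r hr hqr
      refine disjoint_left.2 fun x hx hx' => ?_
      have := hJ.2 q hq r hr hqr
      rw [mem_Ico] at hx hx'
      omega
  rw [Nat.card_eq_fintype_card, Fintype.card_subtype_compl, Fintype.card_fin, Fintype.card_subtype, h2, Nat.mul_sub]

/-- The closing step from `2 * b - 1` to `2 * a` flips parity too, so any return to a point of the
run takes an even number of steps. -/
theorem HasRun.parity {m : ℕ} {σ : Perm (Fin m)} {q : ℕ × ℕ} (h : HasRun σ q) {i : Fin m}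
    (hi : 2 * q.1 ≤ i) (hi' : (i : ℕ) < 2 * q.2) :
    (2 * q.1 ≤ (σ i : ℕ) ∧ (σ i : ℕ) < 2 * q.2) ∧ (σ i : ℕ) % 2 = (i + 1) % 2 := by
  rw [h i hi hi']
  split_ifs <;> omega

theorem HasRun.even_of_pow_apply_eq {m : ℕ} {σ : Perm (Fin m)} {q : ℕ × ℕ} (h : HasRun σ q)
    {i : Fin m} (hi : 2 * q.1 ≤ i) (hi' : (i : ℕ) < 2 * q.2) {k : ℕ} (hk : (σ ^ k) i = i) :
    Even k := by
  have key : ∀ k : ℕ, (2 * q.1 ≤ ((σ ^ k) i : ℕ) ∧ ((σ ^ k) i : ℕ) < 2 * q.2) ∧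
      ((σ ^ k) i : ℕ) % 2 = (i + k) % 2 := by
    intro k
    induction k with
    | zero => exact ⟨⟨hi, hi'⟩, rfl⟩
    | succ k ih =>
      have := h.parity ih.1.1 ih.1.2
      rw [pow_succ', Perm.mul_apply]
      refine ⟨this.1, ?_⟩
      omega
  have := (key k).2
  rw [hk] at this
  rw [Nat.even_iff]
  omega

theorem card_subset_runSet {n : ℕ} {J : Finset (ℕ × ℕ)} (hJ : IsIntervalFamily n J) :
    ((evenCyclePerms n).filter fun σ => J ⊆ runSet σ).card =
      (evenCyclePerms (n - totalLength J)).card := by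
  classical
  obtain ⟨τ, hτ, -⟩ := exists_perm_hasRun hJ
  have hmap : ∀ x, InRuns J x → InRuns J (τ x) := by
    rintro x ⟨q, hq, hx⟩
    exact ⟨q, hq, ((hτ q hq).parity hx.1 hx.2).1⟩
  have hinv : ∀ x, InRuns J (τ x) ↔ InRuns J x := by
    refine fun x => ⟨fun h => ?_, hmap x⟩
    -- An injective self-map of a finite set is onto, so `τ x` already has a preimage inside the
    -- runs.
    obtain ⟨y, hy⟩ := (τ.subtypePermOfFintype hmap).surjective ⟨τ x, h⟩
    rw [← τ.injective (congrArg Subtype.val hy)]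
    exact y.2
  let τ' := τ.subtypePerm hinv
  have hev : EvenPeriods τ' := by
    rintro ⟨x, q, hq, hx⟩ k hk
    refine (hτ q hq).even_of_pow_apply_eq hx.1 hx.2 (k := k) ?_
    rw [Perm.subtypePerm_pow] at hk
    exact congrArg Subtype.val hk
  rw [← card_evenPeriods_extending (InRuns J) τ' hev (card_not_inRuns hJ)]
  congr 1
  ext σ
  simp only [evenCyclePerms, mem_filter, mem_univ, true_and, allCyclesEven_iff_evenPeriods]
  refine and_congr_right fun _ => ⟨?_, fun h q hq => ?_⟩
  · rintro h ⟨x, q, hq, hx⟩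
    refine Fin.ext ?_
    rw [(mem_runSet.1 (h hq)).2.2 x hx.1 hx.2]
    exact (hτ q hq x hx.1 hx.2).symm
  · refine mem_runSet.2 ⟨(hJ.1 q hq).1, (hJ.1 q hq).2, fun i hi hi' => ?_⟩
    rw [h ⟨i, q, hq, hi, hi'⟩]
    exact hτ q hq i hi hi'

theorem numEvenRuns_eq_card_runSet {n : ℕ} {σ : Perm (Fin (2 * n))}
    (hσ : σ ∈ evenCyclePerms n) : numEvenRuns σ = (runSet σ).card := by
  have hlt : ∀ q ∈ runSet σ, 2 * q.1 < 2 * n ∧ 2 * q.2 - 1 < 2 * n := by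
    intro q hq
    obtain ⟨h1, h2, -⟩ := mem_runSet.1 hq
    omega
  have hab : ∀ q (hq : q ∈ runSet σ), (⟨2 * q.1, (hlt q hq).1⟩ : Fin (2 * n)) <
      ⟨2 * q.2 - 1, (hlt q hq).2⟩ := by
    intro q hq
    obtain ⟨h1, h2, -⟩ := mem_runSet.1 hq
    simp only [Fin.lt_def]
    omega
  symm
  refine card_bij (fun q hq => Fin.cycleIcc ⟨2 * q.1, (hlt q hq).1⟩ ⟨2 * q.2 - 1, (hlt q hq).2⟩)
    ?_ ?_ ?_
  · intro q hq
    obtain ⟨h1, h2, h3⟩ := mem_runSet.1 hq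
    rw [mem_filter, Perm.mem_cycleFactorsFinset_iff]
    refine ⟨⟨Fin.isCycle_cycleIcc (hab q hq), fun x hx => ?_⟩, _, _, (hab q hq).le,
      support_cycleIcc (hab q hq), fun x hx hx' => ?_, ?_, ?_⟩
    · rw [support_cycleIcc (hab q hq), mem_Icc] at hx
      refine Fin.ext ?_
      rw [val_cycleIcc hx.1 hx.2]
      simp only [Fin.le_def] at hx
      rw [h3 x hx.1 (by omega)]
      simp only [Fin.ext_iff]
      congr 1
      rw [eq_iff_iff]
      omega
    · rw [val_cycleIcc hx hx'.le, if_neg hx'.ne]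
    · refine Fin.ext ?_
      rw [val_cycleIcc (hab q hq).le le_rfl, if_pos rfl]
    · rw [Nat.even_iff]
      simp only
      omega
  · intro q hq r hr h
    have h1 := congrArg Perm.support h
    simp only [support_cycleIcc (hab q hq), support_cycleIcc (hab r hr)] at h1
    rw [← Finset.coe_inj, coe_Icc, coe_Icc] at h1
    have h2 := (Set.Icc_eq_Icc_iff (hab q hq).le).1 h1
    simp only [Fin.mk.injEq] at h2
    have := mem_runSet.1 hq
    have := mem_runSet.1 hr
    exact Prod.ext (by omega) (by omega)
  · intro c hc
    obtain ⟨hc, a, b, hle, hsupp, hrun, hlast, hb⟩ := mem_filter.1 hc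
    have hcyc := Perm.mem_cycleFactorsFinset_iff.1 hc
    -- Even length together with the parity of the end fixes the parity of the start: zero-based,
    -- `a` is even and `b` odd, so the halvings below are exact.
    have hcard : Even c.support.card := by
      rw [evenCyclePerms, mem_filter] at hσ
      refine hσ.2 _ ?_
      rw [Perm.parts_partition, Perm.cycleType_def]
      exact Multiset.mem_add.2 (.inl (Multiset.mem_map_of_mem _ (Finset.mem_def.1 hc)))
    have hle' : (a : ℕ) ≤ b := hle
    rw [hsupp, Fin.card_Icc, Nat.even_iff] at hcard
    rw [Nat.even_iff] at hb
    have hlt' : a < b := by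
      rw [Fin.lt_def]
      omega
    have ha : 2 * ((a : ℕ) / 2) = a := by omega
    have hb2 : 2 * (((b : ℕ) + 1) / 2) = b + 1 := by omega
    have hval : ∀ x, a ≤ x → x ≤ b → (c x : ℕ) = if x = b then (a : ℕ) else x + 1 := by
      intro x hx hx'
      split_ifs with h
      · rw [h, hlast]
      · exact hrun x hx (lt_of_le_of_ne hx' h)
    have hbn := b.2
    have hmem : ((a : ℕ) / 2, ((b : ℕ) + 1) / 2) ∈ runSet σ := by
      refine mem_runSet.2 ⟨?_, ?_, fun x hx hx' => ?_⟩
      · simp only; omega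
      · simp only; omega
      · simp only [ha, hb2] at hx hx' ⊢
        have hxb : x ≤ b := by rw [Fin.le_def]; omega
        rw [← hcyc.2 x (by rw [hsupp, mem_Icc]; exact ⟨hx, hxb⟩), hval x hx hxb]
        simp only [Fin.ext_iff, Nat.add_right_cancel_iff]
    refine ⟨_, hmem, ?_⟩
    have ea : (⟨2 * ((a : ℕ) / 2), (hlt _ hmem).1⟩ : Fin (2 * n)) = a := Fin.ext ha
    have eb : (⟨2 * (((b : ℕ) + 1) / 2) - 1, (hlt _ hmem).2⟩ : Fin (2 * n)) = b :=
      Fin.ext (by simp only; omega)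
    simp only [ea, eb]
    ext x
    by_cases hx : x ∈ Icc a b
    · have := mem_Icc.1 hx
      rw [val_cycleIcc this.1 this.2, hval x this.1 this.2]
    · rw [cycleIcc_apply_of_notMem hx]
      rw [← hsupp, Perm.notMem_support] at hx
      rw [hx]

/-- Inclusion–exclusion: the binomial expansion over subsets of the runs, followed by an exchange of
sums. -/
theorem sum_X_pow_numEvenRuns (n : ℕ) :
    ∑ σ ∈ evenCyclePerms n, (X : ℚ[X]) ^ numEvenRuns σ = intervalPoly evenCycleGF n := by
  have h : ∀ σ ∈ evenCyclePerms n, (X : ℚ[X]) ^ numEvenRuns σ =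
      ∑ J ∈ intervalFamilies n, if J ⊆ runSet σ then (X - 1) ^ J.card else 0 := by
    intro σ hσ
    have hfilter : (intervalFamilies n).filter (· ⊆ runSet σ) = (runSet σ).powerset := by
      ext J
      rw [mem_filter, mem_powerset, mem_intervalFamilies]
      exact and_iff_right_of_imp isIntervalFamily_of_subset_runSet
    rw [← sum_filter, hfilter, numEvenRuns_eq_card_runSet hσ]
    have := sum_pow_mul_eq_add_pow (X - 1 : ℚ[X]) 1 (runSet σ)
    simpa using this.symm
  rw [sum_congr rfl h, sum_comm, intervalPoly]
  refine sum_congr rfl fun J hJ => ?_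
  rw [← sum_filter, sum_const, card_subset_runSet (mem_intervalFamilies.1 hJ), evenCycleGF,
    PowerSeries.coeff_mk, nsmul_eq_mul, mul_comm]
  simp

end

theorem corollary16 (n k : ℕ) :
    MvPowerSeries.coeff (Finsupp.single 0 n + Finsupp.single 1 k) (runTransform evenCycleGF) =
      (((evenCyclePerms n).filter (fun σ => numEvenRuns σ = k)).card : ℚ) := by
  rw [coeff_runTransform, ← sum_X_pow_numEvenRuns, Polynomial.finsetSum_coeff]
  simp only [Polynomial.coeff_X_pow, eq_comm (a := k)]
  simp
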